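/- Let $n\ge 2$ and let $\lambda_1,\dots,\lambda_{n-2}$ be nonzero real numbers. Write $w_i=\sqrt{|\lambda_i|}$, and let $(\mathrm{c}_i(t),\mathrm{s}_i(t))$ be $(\cos(w_it),\sin(w_it))$ if $\lambda_i>0$ and $(\cosh(w_it),\sinh(w_it))$ if $\lambda_i<0$. Let $G=\mathbb{R}\times\mathbb{R}^{n-2}\times\mathbb{R}^{n-2}\times\mathbb{R}$ be the Lie group with elements $(t,p,q,r)$ and law $(t,h)*(t',h')=(t+t',h\cdot\varphi_t(h'))$, where $$(p,q,r)\cdot(p',q',r')=\Big(p+p',\,q+q',\,r+r'+\tfrac12\sum_i\lambda_i(q_ip'_i-q'_ip_i)\Big),$$ $$\varphi_t(p,q,r)=\Big(\big(\mathrm c_i(t)p_i-\tfrac1{w_i}\mathrm s_i(t)q_i\big)_i,\ \big(\tfrac{\lambda_i}{w_i}\mathrm s_i(t)p_i+\mathrm c_i(t)q_i\big)_i,\ r\Big),$$ and let $K=\{(0,p,0,0)\}\subset G$. The Cahen--Wallach space $M=G/K$ is identified with $\mathbb{R}^n$, with coordinates $(t,x_1,\dots,x_{n-2},v)$, through $$\pi(t,p,q,r)=\Big(t,\,(X_i)_i,\,r+\sum_i\tfrac{\lambda_i}{2}X_i\big(p_i\mathrm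 c_i(t)+\tfrac{q_i}{w_i}\mathrm s_i(t)\big)\Big),\qquad X_i=\tfrac{\lambda_i}{w_i}\mathrm s_i(t)p_i-\mathrm c_i(t)q_i,$$ and $G$ acts on $M$ by $g.\pi(g')=\pi(gg')$. Let $\mathrm{Exp}_0:T_0M\simeq\mathbb{R}^n\to M$ be the exponential mapping at the origin of the invariant Lorentzian metric $\big(\sum_i\lambda_ix_i^2\big)dt\otimes dt+dt\otimes dv+dv\otimes dt-\sum_idx_i\otimes dx_i$. Call $b_0\in\mathbb{R}\setminus\{0\}$ admissible if $b_0\sqrt{\lambda_i}\notin\pi(\mathbb{Z}\setminus\{0\})$ whenever $\lambda_i>0$. For a continuous compactly supported $f:M\to\mathbb{C}$, $y=g.0\in M$, $r>0$ and admissible $b_0$, put $$(M^{r,b_0}_+f)(y)=\int_Kf\Big(gk.\mathrm{Exp}_0\big(b_0,0,\dots,0,\tfrac{r^2}{2b_0}\big)\Big)\,dk,\qquad dk=\Big(\prod_i|\lambda_i|\Big)dp_1\cdots dp_{n-2}$$ (this does not depend on the choice of $g$), and, for $\mu\in\mathbb{C}$ with $\mathrm{Re}(\mu)>n-1$, let the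 generalized Riesz potential be $$(J^{\mu,b_0}_+f)(y)=\frac1{H_{n-1}(\mu)}\int_0^\infty(M^{r,b_0}_+f)(y)\,r^{\mu-n+2}\,dr,\qquad H_{n-1}(\mu)=\pi^{\frac{n-3}2}2^{\mu-1}\,\Gamma\big(\tfrac\mu2\big)\,\Gamma\big(\tfrac{\mu+3-n}2\big).$$ Let $f:M\to\mathbb{C}$ be smooth with compact support and let $b_0$ be admissible. Then, for every $y\in M$: 1. For $f$ and for $\partial f/\partial v$, the integrals above converge absolutely (for all $r>0$ and all $\mathrm{Re}(\mu)>n-1$), and $\mu\mapsto(J^{\mu,b_0}_+f)(y)$ and $\mu\mapsto(J^{\mu,b_0}_+\frac{\partial f}{\partial v})(y)$ extend holomorphically to all of $\mathbb{C}$. The extensions are denoted by the same symbols. 2. $\displaystyle\lim_{\mu\to0}(J^{\mu,b_0}_+f)(y)=0$. 3. For every $\mu\in\mathbb{C}$ the function $J^{\mu,b_0}_+f$ is differentiable in $v$ at $y$, and $$\frac{\partial}{\partial v}(J^{\mu,b_0}_+f)(y)=\Big(J^{\mu,b_0}_+\frac{\partial f}{\partial v}\Big)(y)=-\frac{b_0}{\mu-2}\,(J^{\mu-2,b_0}_+f)(y),$$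 where the last expression is replaced by its limit as $\mu\to2$ when $\mu=2$. -/

import Mathlib

open scoped ContDiff Topology

noncomputable section

namespace CahenWallach

/-- The function written `cos.h (t √|a|)`: `cos (t √a)` for `a > 0` and `cosh (t √(-a))` for
`a < 0`. -/
def cosH (a t : ℝ) : ℝ :=
  if 0 < a then Real.cos (t * √|a|) else Real.cosh (t * √|a|)

/-- The function written `sin.h (t √|a|)`: `sin (t √a)` for `a > 0` and `sinh (t √(-a))` for
`a < 0`. -/
def sinH (a t : ℝ) : ℝ :=
  if 0 < a then Real.sin (t * √|a|) else Real.sinh (t * √|a|)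

lemma cosH_zero (a : ℝ) : cosH a 0 = 1 := by simp [cosH]

lemma sinH_zero (a : ℝ) : sinH a 0 = 0 := by simp [sinH]

lemma cosH_add (a s t : ℝ) : cosH a (s + t) =
    cosH a s * cosH a t - a * (sinH a s / √|a|) * (sinH a t / √|a|) := by
  rcases lt_trichotomy a 0 with h | h | h
  · have hw : √|a| ^ 2 = -a := by rw [Real.sq_sqrt (abs_nonneg a), abs_of_neg h]
    have h0 : √|a| ≠ 0 := (Real.sqrt_pos.2 (abs_pos.2 h.ne)).ne'
    simp only [cosH, sinH, h.not_gt, if_false, add_mul, Real.cosh_add]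
    field_simp
    rw [hw]; ring
  · subst h; simp [cosH, sinH]
  · have hw : √|a| ^ 2 = a := by rw [Real.sq_sqrt (abs_nonneg a), abs_of_pos h]
    have h0 : √|a| ≠ 0 := (Real.sqrt_pos.2 (abs_pos.2 h.ne')).ne'
    simp only [cosH, sinH, h, if_true, add_mul, Real.cos_add]
    field_simp
    rw [hw]; ring

lemma sinH_add (a s t : ℝ) : sinH a (s + t) =
    sinH a s * cosH a t + cosH a s * sinH a t := by
  by_cases h : 0 < a
  · simp only [cosH, sinH, h, if_true, add_mul, Real.sin_add]
  · simp only [cosH, sinH, h, if_false, add_mul, Real.sinh_add]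

lemma cosH_neg (a t : ℝ) : cosH a (-t) = cosH a t := by simp [cosH]

lemma sinH_neg (a t : ℝ) : sinH a (-t) = -sinH a t := by
  by_cases h : 0 < a <;> simp [sinH, h]

lemma cosH_sq_add (a t : ℝ) :
    cosH a t ^ 2 + a * (sinH a t / √|a|) ^ 2 = 1 := by
  have h := cosH_add a t (-t)
  rw [add_neg_cancel, cosH_zero, cosH_neg, sinH_neg] at h
  linear_combination -h

variable {m : ℕ}

/-- The transvection group `G = ℝ^{2n-2}` (with `n = m + 2`) of the Cahen-Wallach space with
parameters `lam`; its elements are the tuples `(t, p, q, r)`. -/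
@[ext]
structure Grp (lam : Fin m → ℝ) where
  t : ℝ
  p : Fin m → ℝ
  q : Fin m → ℝ
  r : ℝ

variable {lam : Fin m → ℝ}

/-- First block of the automorphism `φ_t` of the weighted Heisenberg group. -/
def phiP (lam : Fin m → ℝ) (t : ℝ) (p q : Fin m → ℝ) : Fin m → ℝ := fun i =>
  cosH (lam i) t * p i - 1 / √|lam i| * sinH (lam i) t * q i

/-- Second block of the automorphism `φ_t` of the weighted Heisenberg group
(the third block, the central coordinate, is fixed by `φ_t`). -/
def phiQ (lam : Fin m → ℝ) (t : ℝ) (p q : Fin m → ℝ) : Fin m → ℝ := fun i =>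
  lam i / √|lam i| * sinH (lam i) t * p i + cosH (lam i) t * q i

/-- The group law `(t, h) ∗ (t', h') = (t + t', h · φ_t h')`, where `·` is the weighted
Heisenberg product. -/
instance : Mul (Grp lam) where
  mul g g' :=
    { t := g.t + g'.t
      p := fun i => g.p i + phiP lam g.t g'.p g'.q i
      q := fun i => g.q i + phiQ lam g.t g'.p g'.q i
      r := g.r + g'.r + 1 / 2 * ∑ i, lam i *
        (g.q i * phiP lam g.t g'.p g'.q i - phiQ lam g.t g'.p g'.q i * g.p i) }

instance : One (Grp lam) where
  one := { t := 0, p := 0, q := 0, r := 0 }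

instance : Inv (Grp lam) where
  inv g :=
    { t := -g.t
      p := phiP lam (-g.t) (-g.p) (-g.q)
      q := phiQ lam (-g.t) (-g.p) (-g.q)
      r := -g.r }

@[simp] lemma mul_t (g g' : Grp lam) : (g * g').t = g.t + g'.t := rfl
@[simp] lemma mul_p (g g' : Grp lam) (i : Fin m) :
    (g * g').p i = g.p i + phiP lam g.t g'.p g'.q i := rfl
@[simp] lemma mul_q (g g' : Grp lam) (i : Fin m) :
    (g * g').q i = g.q i + phiQ lam g.t g'.p g'.q i := rfl
@[simp] lemma mul_r (g g' : Grp lam) : (g * g').r = g.r + g'.r + 1 / 2 * ∑ i, lam i *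
    (g.q i * phiP lam g.t g'.p g'.q i - phiQ lam g.t g'.p g'.q i * g.p i) := rfl
@[simp] lemma one_t : (1 : Grp lam).t = 0 := rfl
@[simp] lemma one_p : (1 : Grp lam).p = 0 := rfl
@[simp] lemma one_q : (1 : Grp lam).q = 0 := rfl
@[simp] lemma one_r : (1 : Grp lam).r = 0 := rfl
@[simp] lemma inv_t (g : Grp lam) : g⁻¹.t = -g.t := rfl
@[simp] lemma inv_p (g : Grp lam) : g⁻¹.p = phiP lam (-g.t) (-g.p) (-g.q) := rfl
@[simp] lemma inv_q (g : Grp lam) : g⁻¹.q = phiQ lam (-g.t) (-g.p) (-g.q) := rfl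
@[simp] lemma inv_r (g : Grp lam) : g⁻¹.r = -g.r := rfl

instance : Group (Grp lam) :=
  Group.ofLeftAxioms
    (by
      intro a b c
      ext i
      · simp [add_assoc]
      · simp only [mul_p, mul_q, mul_t, phiP, phiQ, cosH_add, sinH_add]; ring
      · simp only [mul_p, mul_q, mul_t, phiP, phiQ, cosH_add, sinH_add]; ring
      · simp only [mul_r, mul_p, mul_q, mul_t]
        have key : ∀ (A B C D : Fin m → ℝ), (∀ i, A i + B i = C i + D i) →
            a.r + b.r + 1 / 2 * ∑ i, A i + c.r + 1 / 2 * ∑ i, B i =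
              a.r + (b.r + c.r + 1 / 2 * ∑ i, C i) + 1 / 2 * ∑ i, D i := by
          intro A B C D h
          have : ∑ i, A i + ∑ i, B i = ∑ i, C i + ∑ i, D i := by
            rw [← Finset.sum_add_distrib, ← Finset.sum_add_distrib]
            exact Finset.sum_congr rfl fun i _ => h i
          linarith
        apply key
        intro i
        simp only [mul_p, mul_q, phiP, phiQ, cosH_add, sinH_add]
        have h := cosH_sq_add (lam i) a.t
        linear_combination (lam i) * (b.q i * (cosH (lam i) b.t * c.p i
          - 1 / √|lam i| * sinH (lam i) b.t * c.q i)
          - (lam i / √|lam i| * sinH (lam i) b.t * c.p i + cosH (lam i) b.t * c.q i) * b.p i) * h)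
    (by
      intro a
      ext i <;> simp [phiP, phiQ, cosH_zero, sinH_zero])
    (by
      intro a
      ext i
      · simp
      · simp [phiP]
      · simp only [mul_q, inv_q, inv_t, phiQ, Pi.neg_apply, one_q, Pi.zero_apply]; ring
      · simp only [mul_r, inv_r, inv_p, inv_q, inv_t, one_r]
        have : ∀ i, lam i * (phiQ lam (-a.t) (-a.p) (-a.q) i * phiP lam (-a.t) a.p a.q i
            - phiQ lam (-a.t) a.p a.q i * phiP lam (-a.t) (-a.p) (-a.q) i) = 0 := by
          intro i
          simp only [phiP, phiQ, Pi.neg_apply]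
          ring
        simp [this])

/-- The Cahen-Wallach space `M = ℝ^n`, `n = m + 2`, in its global coordinates `(t, x, v)`. The same
type serves for its tangent spaces, with coordinates `(b₀, b, b')`. -/
abbrev Space (m : ℕ) : Type := ℝ × (Fin m → ℝ) × ℝ

/-- The map `π : G → M` that identifies `G / K` with `M`. -/
def proj (g : Grp lam) : Space m :=
  (g.t,
   fun i => lam i / √|lam i| * sinH (lam i) g.t * g.p i - cosH (lam i) g.t * g.q i,
   g.r + ∑ i, lam i / 2 *
    (lam i / √|lam i| * sinH (lam i) g.t * g.p i - cosH (lam i) g.t * g.q i) *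
    (g.p i * cosH (lam i) g.t + g.q i / √|lam i| * sinH (lam i) g.t))

/-- The isotropy subgroup `K`, parametrised by `p ∈ ℝ^{n-2}`. -/
def isoK (lam : Fin m → ℝ) (p : Fin m → ℝ) : Grp lam := { t := 0, p := p, q := 0, r := 0 }

/-- A global section of `π`. -/
def lift (lam : Fin m → ℝ) (y : Space m) : Grp lam :=
  { t := y.1, p := phiP lam y.1 0 (-y.2.1), q := phiQ lam y.1 0 (-y.2.1), r := y.2.2 }

/-- The action of `G` on `M`, so that `g . π(g') = π(g g')`; see `act_proj`. -/
def act (g : Grp lam) (y : Space m) : Space m := proj (g * lift lam y)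

lemma proj_lift (y : Space m) : proj (lift lam y) = y := by
  have h2 : ∀ i, lam i / √|lam i| * sinH (lam i) y.1 * phiP lam y.1 0 (-y.2.1) i
      - cosH (lam i) y.1 * phiQ lam y.1 0 (-y.2.1) i = y.2.1 i := by
    intro i
    simp only [phiP, phiQ, Pi.neg_apply, Pi.zero_apply]
    linear_combination y.2.1 i * cosH_sq_add (lam i) y.1
  have h3 : ∀ i, phiP lam y.1 0 (-y.2.1) i * cosH (lam i) y.1
      + phiQ lam y.1 0 (-y.2.1) i / √|lam i| * sinH (lam i) y.1 = 0 := by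
    intro i
    simp only [phiP, phiQ, Pi.neg_apply, Pi.zero_apply]
    ring
  refine Prod.ext rfl (Prod.ext ?_ ?_)
  · funext i; exact h2 i
  · simp only [proj, lift, h3]; simp

lemma isoK_add (p p' : Fin m → ℝ) : isoK lam (p + p') = isoK lam p * isoK lam p' := by
  ext i <;> simp [isoK, phiP, phiQ, cosH_zero, sinH_zero]

lemma exists_eq_lift_mul (g : Grp lam) : ∃ p, g = lift lam (proj g) * isoK lam p := by
  refine ⟨fun i => cosH (lam i) g.t * g.p i + sinH (lam i) g.t / √|lam i| * g.q i, ?_⟩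
  have hp : ∀ i, g.p i = (lift lam (proj g) *
      isoK lam (fun i => cosH (lam i) g.t * g.p i + sinH (lam i) g.t / √|lam i| * g.q i)).p i := by
    intro i
    simp only [mul_p, lift, isoK, phiP, proj, Pi.neg_apply, Pi.zero_apply]
    linear_combination -g.p i * cosH_sq_add (lam i) g.t
  have hq : ∀ i, g.q i = (lift lam (proj g) *
      isoK lam (fun i => cosH (lam i) g.t * g.p i + sinH (lam i) g.t / √|lam i| * g.q i)).q i := by
    intro i
    simp only [mul_q, lift, isoK, phiQ, proj, Pi.neg_apply, Pi.zero_apply]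
    linear_combination -g.q i * cosH_sq_add (lam i) g.t
  ext i
  · simp [lift, isoK, proj]
  · exact hp i
  · exact hq i
  · simp only [mul_r, lift, isoK, proj, phiP, phiQ, Pi.neg_apply, Pi.zero_apply]
    rw [Finset.mul_sum, add_zero, add_assoc, ← Finset.sum_add_distrib,
      Finset.sum_eq_zero, add_zero]
    intro i _
    linear_combination -(lam i / 2) * (cosH (lam i) g.t * g.p i
      + sinH (lam i) g.t / √|lam i| * g.q i) *
      (lam i / √|lam i| * sinH (lam i) g.t * g.p i - cosH (lam i) g.t * g.q i) *
      cosH_sq_add (lam i) g.t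

lemma proj_mul_isoK (g : Grp lam) (p : Fin m → ℝ) : proj (g * isoK lam p) = proj g := by
  have h2 : ∀ i, lam i / √|lam i| * sinH (lam i) g.t * (g * isoK lam p).p i
      - cosH (lam i) g.t * (g * isoK lam p).q i =
      lam i / √|lam i| * sinH (lam i) g.t * g.p i - cosH (lam i) g.t * g.q i := by
    intro i
    simp only [mul_p, mul_q, isoK, phiP, phiQ, Pi.zero_apply]
    ring
  have h3 : ∀ i, (g * isoK lam p).p i * cosH (lam i) g.t
      + (g * isoK lam p).q i / √|lam i| * sinH (lam i) g.t =
      g.p i * cosH (lam i) g.t + g.q i / √|lam i| * sinH (lam i) g.t + p i := by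
    intro i
    simp only [mul_p, mul_q, isoK, phiP, phiQ, Pi.zero_apply]
    linear_combination p i * cosH_sq_add (lam i) g.t
  have ht : (g * isoK lam p).t = g.t := by simp [isoK]
  refine Prod.ext ?_ (Prod.ext ?_ ?_)
  · exact ht
  · funext i; simp only [proj]; rw [ht]; exact h2 i
  · simp only [proj]; rw [ht]; simp only [h2, h3]
    simp only [mul_r, isoK, phiP, phiQ, Pi.zero_apply]
    rw [add_zero, add_assoc, Finset.mul_sum, ← Finset.sum_add_distrib]
    congr 1
    refine Finset.sum_congr rfl fun i _ => ?_
    ring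

lemma act_proj (g g' : Grp lam) : act g (proj g') = proj (g * g') := by
  obtain ⟨p, hp⟩ := exists_eq_lift_mul g'
  conv_rhs => rw [hp, ← mul_assoc, proj_mul_isoK]
  rfl

lemma act_one (y : Space m) : act (1 : Grp lam) y = y := by
  rw [act, one_mul, proj_lift]

lemma act_mul (g g' : Grp lam) (y : Space m) : act (g * g') y = act g (act g' y) := by
  rw [act, mul_assoc, ← act_proj]; rfl

lemma act_zero (g : Grp lam) : act g 0 = proj g := by
  have : lift lam (0 : Space m) = 1 := by
    ext i <;> simp [lift, phiP, phiQ]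
  rw [act, this, mul_one]

/-- The Lorentzian metric
`(∑ λᵢ xᵢ²) dt ⊗ dt + dt ⊗ dv + dv ⊗ dt - ∑ dxᵢ ⊗ dxᵢ` at the point `y`. -/
def metric (lam : Fin m → ℝ) (y X Y : Space m) : ℝ :=
  (∑ i, lam i * y.2.1 i ^ 2) * X.1 * Y.1 + X.1 * Y.2.2 + X.2.2 * Y.1 - ∑ i, X.2.1 i * Y.2.1 i

/-- The geodesic equation of the metric `ĝ` in global coordinates, for all `s` and all constant
vector fields `w`: `d/ds ĝ(γ', w) = (1/2) (∂_w ĝ)(γ', γ')`. -/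
def IsGeodesic (lam : Fin m → ℝ) (γ : ℝ → Space m) : Prop :=
  ∃ γ' : ℝ → Space m, (∀ s, HasDerivAt γ (γ' s) s) ∧
    ∀ s (w : Space m), HasDerivAt (fun σ => metric lam (γ σ) (γ' σ) w)
      (1 / 2 * deriv (fun ε : ℝ => metric lam (γ s + ε • w) (γ' s) (γ' s)) 0) s

/-- The exponential mapping of `M` at the base point `0`; see `isGeodesic_expMap`. -/
def expMap (lam : Fin m → ℝ) (X : Space m) : Space m :=
  if X.1 = 0 then X
  else
    (X.1,
     fun i => sinH (lam i) X.1 / (X.1 * √|lam i|) * X.2.1 i,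
     1 / (2 * X.1) * (2 * X.1 * X.2.2 - ∑ i, X.2.1 i ^ 2)
      + ∑ i, X.2.1 i ^ 2 / (4 * X.1 ^ 2 * √|lam i|) * sinH (lam i) (2 * X.1))

lemma hasDerivAt_sinH (a b s : ℝ) :
    HasDerivAt (fun σ => sinH a (σ * b)) (b * √|a| * cosH a (s * b)) s := by
  have h : HasDerivAt (fun σ : ℝ => σ * b * √|a|) (b * √|a|) s := by
    simpa using ((hasDerivAt_id s).mul_const b).mul_const (√|a|)
  by_cases ha : 0 < a
  · simp only [sinH, cosH, ha, if_true]
    simpa [mul_comm] using h.sin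
  · simp only [sinH, cosH, ha, if_false]
    simpa [mul_comm] using h.sinh

lemma hasDerivAt_cosH (a b s : ℝ) :
    HasDerivAt (fun σ => cosH a (σ * b)) (-(b * (a / √|a|) * sinH a (s * b))) s := by
  have h : HasDerivAt (fun σ : ℝ => σ * b * √|a|) (b * √|a|) s := by
    simpa using ((hasDerivAt_id s).mul_const b).mul_const (√|a|)
  have hw : √|a| * √|a| = |a| := Real.mul_self_sqrt (abs_nonneg a)
  rcases lt_trichotomy a 0 with ha | ha | ha
  · have e : a / √|a| = -√|a| := by
      rw [div_eq_iff (Real.sqrt_pos.2 (abs_pos.2 ha.ne)).ne']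
      rw [neg_mul, hw, abs_of_neg ha, neg_neg]
    rw [e]
    simp only [sinH, cosH, ha.not_gt, if_false]
    simpa [mul_comm] using h.cosh
  · subst ha; simpa [cosH] using hasDerivAt_const s (1 : ℝ)
  · have e : a / √|a| = √|a| := by
      rw [div_eq_iff (Real.sqrt_pos.2 (abs_pos.2 ha.ne')).ne', hw, abs_of_pos ha]
    rw [e]
    simp only [sinH, cosH, ha, if_true]
    simpa [mul_comm] using h.cos

lemma expMap_smul (hlam : ∀ i, lam i ≠ 0) (X : Space m) (hX : X.1 ≠ 0) (s : ℝ) :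
    expMap lam (s • X) =
      (s * X.1, fun i => sinH (lam i) (s * X.1) * (X.2.1 i / (X.1 * √|lam i|)),
        s * (X.2.2 - 1 / (2 * X.1) * ∑ i, X.2.1 i ^ 2)
          + ∑ i, X.2.1 i ^ 2 / (4 * X.1 ^ 2 * √|lam i|) * sinH (lam i) (s * (2 * X.1))) := by
  have hw : ∀ i, √|lam i| ≠ 0 := fun i => (Real.sqrt_pos.2 (abs_pos.2 (hlam i))).ne'
  by_cases hs : s = 0
  · subst hs
    refine Prod.ext ?_ (Prod.ext ?_ ?_)
    · simp [expMap]
    · funext i; simp [expMap, sinH_zero]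
    · simp [expMap, sinH_zero]
  · have h1 : (s • X).1 ≠ 0 := mul_ne_zero hs hX
    rw [expMap, if_neg h1]
    refine Prod.ext rfl (Prod.ext ?_ ?_)
    · funext i
      have := hw i
      simp only [Prod.smul_fst, Prod.smul_snd, Pi.smul_apply, smul_eq_mul]
      field_simp
    · simp only [Prod.smul_fst, Prod.smul_snd, Pi.smul_apply, smul_eq_mul]
      congr 1
      · simp only [mul_pow, ← Finset.mul_sum]
        field_simp
      · refine Finset.sum_congr rfl fun i _ => ?_
        have := hw i
        rw [show 2 * (s * X.1) = s * (2 * X.1) by ring]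
        field_simp

/-- `s ↦ Exp₀ (s X)` is the geodesic that starts at `0` with velocity `X`. -/
theorem isGeodesic_expMap (hlam : ∀ i, lam i ≠ 0) (X : Space m) :
    IsGeodesic lam (fun s : ℝ => expMap lam (s • X)) ∧
      expMap lam (0 : Space m) = 0 ∧ HasDerivAt (fun s : ℝ => expMap lam (s • X)) X 0 := by
  have h0 : expMap lam (0 : Space m) = 0 := by simp [expMap]
  by_cases hX : X.1 = 0
  · have he : (fun s : ℝ => expMap lam (s • X)) = fun s => s • X := by
      funext s; simp [expMap, hX]
    have hd : ∀ s : ℝ, HasDerivAt (fun s : ℝ => s • X) X s := fun s => by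
      simpa using (hasDerivAt_id s).smul_const X
    rw [he]
    refine ⟨⟨fun _ => X, hd, fun s w => ?_⟩, h0, hd 0⟩
    simp only [metric, hX, mul_zero, zero_mul, zero_add, add_zero, deriv_const]
    exact hasDerivAt_const _ _
  · have hw : ∀ i, √|lam i| ≠ 0 := fun i => (Real.sqrt_pos.2 (abs_pos.2 (hlam i))).ne'
    have he : (fun s : ℝ => expMap lam (s • X)) = _ := funext (expMap_smul hlam X hX)
    let γ' : ℝ → Space m := fun s =>
      (X.1, fun i => cosH (lam i) (s * X.1) * X.2.1 i,
        (X.2.2 - 1 / (2 * X.1) * ∑ i, X.2.1 i ^ 2)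
          + ∑ i, X.2.1 i ^ 2 / (2 * X.1) * cosH (lam i) (s * (2 * X.1)))
    have hd : ∀ s : ℝ, HasDerivAt (fun s : ℝ => expMap lam (s • X)) (γ' s) s := by
      intro s
      rw [he]
      refine HasDerivAt.prodMk ?_ (HasDerivAt.prodMk ?_ (HasDerivAt.add ?_ ?_))
      · simpa using (hasDerivAt_id s).mul_const X.1
      · rw [hasDerivAt_pi]
        intro i
        refine ((hasDerivAt_sinH (lam i) X.1 s).mul_const
          (X.2.1 i / (X.1 * √|lam i|))).congr_deriv ?_
        have := hw i
        field_simp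
      · simpa using (hasDerivAt_id s).mul_const (X.2.2 - 1 / (2 * X.1) * ∑ i, X.2.1 i ^ 2)
      · refine HasDerivAt.fun_sum fun i _ => ?_
        refine ((hasDerivAt_sinH (lam i) (2 * X.1) s).const_mul
          (X.2.1 i ^ 2 / (4 * X.1 ^ 2 * √|lam i|))).congr_deriv ?_
        have := hw i
        field_simp
        ring
    refine ⟨⟨γ', hd, fun s w => ?_⟩, h0, ?_⟩
    · have e1 : (fun σ => metric lam (expMap lam (σ • X)) (γ' σ) w) = fun σ =>
          X.2.2 * w.1 + X.1 * w.2.2 - ∑ i, cosH (lam i) (σ * X.1) * (X.2.1 i * w.2.1 i) := by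
        funext σ
        rw [expMap_smul hlam X hX]
        have key : (∑ i, lam i * (sinH (lam i) (σ * X.1) * (X.2.1 i / (X.1 * √|lam i|))) ^ 2) * X.1
            + ∑ i, X.2.1 i ^ 2 / (2 * X.1) * cosH (lam i) (σ * (2 * X.1))
            = 1 / (2 * X.1) * ∑ i, X.2.1 i ^ 2 := by
          rw [Finset.sum_mul, Finset.mul_sum, ← Finset.sum_add_distrib]
          refine Finset.sum_congr rfl fun i _ => ?_
          have h2 : cosH (lam i) (σ * (2 * X.1)) =
              1 - 2 * lam i * (sinH (lam i) (σ * X.1) / √|lam i|) ^ 2 := by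
            rw [show σ * (2 * X.1) = σ * X.1 + σ * X.1 by ring, cosH_add]
            linear_combination cosH_sq_add (lam i) (σ * X.1)
          rw [h2]
          have := hw i
          field_simp
          ring
        simp only [metric, γ']
        have e2 : ∑ i, cosH (lam i) (σ * X.1) * (X.2.1 i * w.2.1 i) =
            ∑ i, cosH (lam i) (σ * X.1) * X.2.1 i * w.2.1 i :=
          Finset.sum_congr rfl fun i _ => by ring
        rw [e2]
        linear_combination w.1 * key
      have e3 : HasDerivAt (fun ε : ℝ =>
          metric lam (expMap lam (s • X) + ε • w) (γ' s) (γ' s))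
          (∑ i, 2 * lam i * (sinH (lam i) (s * X.1) * (X.2.1 i / (X.1 * √|lam i|))) * w.2.1 i
            * X.1 ^ 2) 0 := by
        rw [expMap_smul hlam X hX]
        simp only [metric, γ', Prod.snd_add, Prod.fst_add, Prod.smul_fst, Prod.smul_snd,
          Pi.add_apply, Pi.smul_apply, smul_eq_mul]
        refine HasDerivAt.sub_const _ (HasDerivAt.add_const _ (HasDerivAt.add_const _ ?_))
        simp only [Finset.sum_mul]
        refine HasDerivAt.fun_sum fun i _ => ?_
        have h1 := (((((hasDerivAt_id (0 : ℝ)).mul_const (w.2.1 i)).const_add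
          (sinH (lam i) (s * X.1) * (X.2.1 i / (X.1 * √|lam i|)))).pow 2).const_mul
            (lam i)).mul_const X.1 |>.mul_const X.1
        refine h1.congr_deriv ?_
        simp
        ring
      rw [e1, e3.deriv]
      have e4 : HasDerivAt (fun σ => ∑ i, cosH (lam i) (σ * X.1) * (X.2.1 i * w.2.1 i))
          (∑ i, -(X.1 * (lam i / √|lam i|) * sinH (lam i) (s * X.1)) * (X.2.1 i * w.2.1 i)) s :=
        HasDerivAt.fun_sum fun i _ => (hasDerivAt_cosH (lam i) X.1 s).mul_const _
      refine (e4.const_sub (X.2.2 * w.1 + X.1 * w.2.2)).congr_deriv ?_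
      rw [Finset.mul_sum, ← Finset.sum_neg_distrib]
      refine Finset.sum_congr rfl fun i _ => ?_
      have := hw i
      field_simp
    · refine (hd 0).congr_deriv ?_
      refine Prod.ext rfl (Prod.ext ?_ ?_)
      · funext i; simp [γ', cosH_zero]
      · simp only [γ', zero_mul, cosH_zero, mul_one]
        rw [← Finset.sum_div]
        ring

/-- The orbital integral `(M^X f)(y) = ∫_K f(g k . Exp₀ X) dk`, where `y = g . 0` and
`dk = (∏ |λᵢ|) dp₁ ⋯ dp_{n-2}`. It does not depend on the choice of `g`; see
`orbitalIntegral_eq`. -/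
def orbitalIntegral (lam : Fin m → ℝ) (f : Space m → ℂ) (X y : Space m) : ℂ :=
  ((∏ i, |lam i| : ℝ) : ℂ) *
    ∫ p : Fin m → ℝ, f (act (lift lam y * isoK lam p) (expMap lam X))

theorem orbitalIntegral_eq (f : Space m → ℂ) (X y : Space m) (g : Grp lam) (hg : act g 0 = y) :
    orbitalIntegral lam f X y = ((∏ i, |lam i| : ℝ) : ℂ) *
      ∫ p : Fin m → ℝ, f (act (g * isoK lam p) (expMap lam X)) := by
  rw [act_zero] at hg
  obtain ⟨p₀, hp⟩ := exists_eq_lift_mul g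
  rw [hg] at hp
  rw [hp, orbitalIntegral]
  simp only [mul_assoc (lift lam y), ← isoK_add]
  rw [MeasureTheory.integral_add_left_eq_self
    (fun p => f (act (lift lam y * isoK lam p) (expMap lam X))) p₀]

/-- The vector `X = (b₀, 0, …, 0, r² / (2 b₀))` of `T₀ M`. -/
def plusVector (m : ℕ) (b₀ r : ℝ) : Space m := (b₀, 0, r ^ 2 / (2 * b₀))

/-- The orbital integral `(M₊^{r, b₀} f)(y)`. -/
def orbitalPlus (lam : Fin m → ℝ) (f : Space m → ℂ) (b₀ r : ℝ) (y : Space m) : ℂ :=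
  orbitalIntegral lam f (plusVector m b₀ r) y

/-- `H_k(μ) = π^{(k-2)/2} 2^{μ-1} Γ(μ/2) Γ((μ+2-k)/2)`. -/
def rieszH (k : ℕ) (μ : ℂ) : ℂ :=
  (Real.pi : ℂ) ^ (((k : ℂ) - 2) / 2) * (2 : ℂ) ^ (μ - 1) *
    Complex.Gamma (μ / 2) * Complex.Gamma ((μ + 2 - k) / 2)

/-- The integrand `(M₊^{r, b₀} f)(y) r^{μ-n+2}` of the generalized Riesz potential, `n = m + 2`. -/
def rieszIntegrand (lam : Fin m → ℝ) (f : Space m → ℂ) (b₀ : ℝ) (y : Space m) (μ : ℂ) (r : ℝ) :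
    ℂ :=
  orbitalPlus lam f b₀ r y * (r : ℂ) ^ (μ - ((m + 2 : ℕ) : ℂ) + 2)

/-- The generalized Riesz potential `(J₊^{μ, b₀} f)(y)`, defined for `Re μ > n - 1`, where
`n = m + 2`. -/
def rieszPotential (lam : Fin m → ℝ) (f : Space m → ℂ) (b₀ : ℝ) (y : Space m) (μ : ℂ) : ℂ :=
  1 / rieszH (m + 1) μ * ∫ r in Set.Ioi (0 : ℝ), rieszIntegrand lam f b₀ y μ r

/-- The admissible values of `b₀`. -/
def Admissible (lam : Fin m → ℝ) (b₀ : ℝ) : Prop :=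
  b₀ ≠ 0 ∧ ∀ i, 0 < lam i → ∀ k : ℤ, k ≠ 0 → b₀ * √(lam i) ≠ k * Real.pi

/-- The vector field `∂/∂v` applied to a function on `M`. -/
def vDeriv (f : Space m → ℂ) (y : Space m) : ℂ :=
  deriv (fun v : ℝ => f (y.1, y.2.1, v)) y.2.2

/-- All integrals in the definition of `(J₊^{μ, b₀} f)(y)` converge absolutely for
`Re μ > n - 1 = m + 1`. -/
def RieszConverges (lam : Fin m → ℝ) (f : Space m → ℂ) (b₀ : ℝ) (y : Space m) : Prop :=
  (∀ r : ℝ, 0 < r → MeasureTheory.Integrable (fun p : Fin m → ℝ =>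
    f (act (lift lam y * isoK lam p) (expMap lam (plusVector m b₀ r))))) ∧
  ∀ μ : ℂ, (m : ℝ) + 1 < μ.re →
    MeasureTheory.IntegrableOn (rieszIntegrand lam f b₀ y μ) (Set.Ioi 0)

/-- `F` is a holomorphic extension of `μ ↦ (J₊^{μ, b₀} f)(y)`, `Re μ > n - 1 = m + 1`, to all
of `ℂ`. -/
def IsEntireExtension (lam : Fin m → ℝ) (f : Space m → ℂ) (b₀ : ℝ) (y : Space m) (F : ℂ → ℂ) :
    Prop :=
  Differentiable ℂ F ∧ ∀ μ : ℂ, (m : ℝ) + 1 < μ.re → F μ = rieszPotential lam f b₀ y μ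

end CahenWallach

end

namespace CahenWallach

open Set Filter MeasureTheory Asymptotics

/-! ### Mellin transforms of test functions -/

section Mellin

variable {ψ : ℝ → ℂ}

/-! The problem reduces to a one-dimensional Riemann-Liouville integral. The coordinate `v` is
central, so for fixed `(t, x)` the orbital integral depends on `v` and `r` only through `v + r² / (2
b₀)`: it is `Φ (v + c r²)` with `Φ = orbitMean` and `c = (2 b₀)⁻¹`. Admissibility makes the
`x`-coordinates of the orbit an invertible affine function of `p`. Hence only a compact set of
parameters meets the support of `f`, and `Φ` is smooth with compact support, with `Φ'` the orbital
integral of `∂f/∂v`.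

Substituting `u = r²` turns the Riesz integral into half the Mellin transform of `u ↦ Φ (v + c u)`
at `a = (μ - m + 1) / 2`. The second Gamma factor of `rieszH` is exactly `Γ(a)`, and dividing by it
gives an expression that integration by parts continues to all `a` (`rayRiesz_succ`,
`differentiable_riemannLiouville`).

The remaining factor `1 / Γ(μ/2)` is entire and vanishes at `0`, which gives the limit.
Differentiation in `v` replaces `Φ` by `Φ'`, which up to the factor `-c` lowers `a` by one, that is,
`μ` by two (`riemannLiouville_sub_one`). The recursion of `1 / Γ(μ/2)` and the power of `2` supply
the constant `-b₀ / (μ - 2)`. -/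

lemma eventuallyEq_zero_atTop_of_hasCompactSupport (hc : HasCompactSupport ψ) : ψ =ᶠ[atTop] 0 :=
  (hasCompactSupport_iff_eventuallyEq.1 hc).filter_mono
    (atTop_le_cocompact.trans_eq coclosedCompact_eq_cocompact.symm)

lemma isBigO_atTop_rpow_of_hasCompactSupport (hc : HasCompactSupport ψ) (a : ℝ) :
    ψ =O[atTop] (fun t : ℝ => t ^ a) := by
  exact (eventuallyEq_zero_atTop_of_hasCompactSupport hc).trans_isBigO (isBigO_zero _ _)

lemma isBigO_zero_rpow_of_continuous (hψ : Continuous ψ) :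
    ψ =O[𝓝[>] 0] (fun t : ℝ => t ^ (-(0 : ℝ))) := by
  simpa using (hψ.tendsto 0).isBigO_one ℝ |>.mono nhdsWithin_le_nhds

/-- Vanishing near infinity removes any upper bound on `Re s`; boundedness near `0` leaves only `Re
s > 0`. -/
lemma mellinConvergent_of_hasCompactSupport (hψ : Continuous ψ) (hc : HasCompactSupport ψ) {s : ℂ}
    (hs : 0 < s.re) : MellinConvergent ψ s :=
  mellinConvergent_of_isBigO_rpow (hψ.locallyIntegrable.locallyIntegrableOn _)
    (isBigO_atTop_rpow_of_hasCompactSupport hc _) (lt_add_one _)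
    (isBigO_zero_rpow_of_continuous hψ) hs

lemma differentiableAt_mellin_of_hasCompactSupport (hψ : Continuous ψ) (hc : HasCompactSupport ψ)
    {s : ℂ} (hs : 0 < s.re) : DifferentiableAt ℂ (mellin ψ) s :=
  mellin_differentiableAt_of_isBigO_rpow (hψ.locallyIntegrable.locallyIntegrableOn _)
    (isBigO_atTop_rpow_of_hasCompactSupport hc _) (lt_add_one _)
    (isBigO_zero_rpow_of_continuous hψ) hs

/-- Integration by parts for the Mellin transform of a test function. -/
lemma mellin_deriv_add_one (hψ : ContDiff ℝ 1 ψ) (hc : HasCompactSupport ψ) {s : ℂ}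
    (hs : 0 < s.re) : mellin (deriv ψ) (s + 1) = -s * mellin ψ s := by
  have hs0 : s ≠ 0 := by rintro rfl; simp at hs
  have hd : Continuous (deriv ψ) := hψ.continuous_deriv le_rfl
  have h1 := mellinConvergent_of_hasCompactSupport hψ.continuous hc hs
  have h2 := mellinConvergent_of_hasCompactSupport (s := s + 1) hd hc.deriv
    (by simp; linarith)
  simp only [MellinConvergent, smul_eq_mul, add_sub_cancel_right] at h1 h2
  have hcpow : Tendsto (fun t : ℝ => (t : ℂ) ^ s) (𝓝 0) (𝓝 0) := by
    have := (Complex.continuous_ofReal_cpow_const hs).tendsto 0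
    rwa [Complex.ofReal_zero, Complex.zero_cpow hs0] at this
  have hparts := integral_Ioi_mul_deriv_eq_deriv_mul (a := (0 : ℝ)) (u := ψ) (u' := deriv ψ)
    (v := fun t : ℝ => (t : ℂ) ^ s) (v' := fun t : ℝ => s * (t : ℂ) ^ (s - 1)) (a' := 0) (b' := 0)
    (fun x _ => (hψ.differentiable one_ne_zero x).hasDerivAt)
    -- The library gives the derivative of `t ^ (r + 1) / (r + 1)` for `r ≠ -1`; it is used with `r
    -- = s - 1` and multiplied by `s`.
    (fun x hx => by
      simpa using hasDerivAt_ofReal_cpow_const' (ne_of_gt (mem_Ioi.1 hx)) (r := s - 1)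
        (by simpa [sub_eq_iff_eq_add] using hs0) |>.const_mul s |>.congr_deriv rfl
        |>.congr_of_eventuallyEq (by
          refine Eventually.of_forall fun t => ?_
          simp only [sub_add_cancel]
          field_simp))
    (IntegrableOn.congr_fun (h1.const_mul s)
      (fun t _ => by simp only [Pi.mul_apply]; ring) measurableSet_Ioi)
    (h2.congr_fun (fun t _ => by simp only [Pi.mul_apply]; ring) measurableSet_Ioi)
    (by
      have := (hψ.continuous.tendsto 0).mul hcpow
      rw [mul_zero] at this
      exact this.mono_left nhdsWithin_le_nhds)
    (by
      refine tendsto_const_nhds.congr' ?_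
      filter_upwards [eventuallyEq_zero_atTop_of_hasCompactSupport hc] with t ht
      simp [ht])
  simp only [mellin, smul_eq_mul, add_sub_cancel_right]
  have e1 : ∫ t in Ioi (0 : ℝ), ψ t * (s * (t : ℂ) ^ (s - 1)) =
      s * ∫ t in Ioi (0 : ℝ), (t : ℂ) ^ (s - 1) * ψ t := by
    rw [← integral_const_mul]
    exact integral_congr_ae (Eventually.of_forall fun t => by ring)
  have e2 : ∫ t in Ioi (0 : ℝ), deriv ψ t * (t : ℂ) ^ s =
      ∫ t in Ioi (0 : ℝ), (t : ℂ) ^ s * deriv ψ t :=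
    integral_congr_ae (Eventually.of_forall fun t => by ring)
  rw [e1, e2] at hparts
  linear_combination hparts

end Mellin

/-! ### Riemann-Liouville integrals along an affine ray and their continuation -/

section AffineComp

variable {Φ : ℝ → ℂ} {c : ℝ}

lemma hasCompactSupport_comp_affine (hc : c ≠ 0) (hΦ : HasCompactSupport Φ) (v : ℝ) :
    HasCompactSupport fun u => Φ (v + c * u) :=
  hΦ.comp_homeomorph ((Homeomorph.mulLeft₀ c hc).trans (Homeomorph.addLeft v))

lemma hasDerivAt_comp_affine (hΦ : Differentiable ℝ Φ) (v u : ℝ) :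
    HasDerivAt (fun u => Φ (v + c * u)) (c * deriv Φ (v + c * u)) u := by
  have h : HasDerivAt (fun u : ℝ => v + c * u) c u := by
    simpa using ((hasDerivAt_id u).const_mul c).const_add v
  refine ((hΦ (v + c * u)).hasDerivAt.scomp u h).congr_deriv ?_
  simp

/-- The Mellin transform of a test function along an affine ray. -/
noncomputable def rayMellin (Φ : ℝ → ℂ) (c v : ℝ) (s : ℂ) : ℂ := mellin (fun u => Φ (v + c * u)) s

lemma rayMellin_deriv_add_one (hΦ : ContDiff ℝ 1 Φ) (hc : HasCompactSupport Φ) (hc0 : c ≠ 0)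
    (v : ℝ) {s : ℂ} (hs : 0 < s.re) :
    c * rayMellin (deriv Φ) c v (s + 1) = -s * rayMellin Φ c v s := by
  have hd : deriv (fun u => Φ (v + c * u)) = fun u => (c : ℂ) • deriv Φ (v + c * u) :=
    funext fun u => (hasDerivAt_comp_affine (hΦ.differentiable one_ne_zero) v u).deriv
  have h := mellin_deriv_add_one (ψ := fun u => Φ (v + c * u)) (by fun_prop)
    (hasCompactSupport_comp_affine hc0 hc v) hs
  rwa [hd, mellin_const_smul] at h

lemma differentiableAt_rayMellin (hΦ : Continuous Φ) (hc : HasCompactSupport Φ) (hc0 : c ≠ 0)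
    (v : ℝ) {s : ℂ} (hs : 0 < s.re) : DifferentiableAt ℂ (rayMellin Φ c v) s :=
  differentiableAt_mellin_of_hasCompactSupport (by fun_prop)
    (hasCompactSupport_comp_affine hc0 hc v) hs

/-- Differentiation under the integral: for base points within distance one of `v`, the
differentiated integrands vanish outside a common bounded interval of `u`, where `u ^ (Re s - 1)` is
integrable at `0`. -/
lemma hasDerivAt_rayMellin (hΦ : ContDiff ℝ 1 Φ) (hc : HasCompactSupport Φ) (hc0 : c ≠ 0)
    (v : ℝ) {s : ℂ} (hs : 0 < s.re) :
    HasDerivAt (fun v => rayMellin Φ c v s) (rayMellin (deriv Φ) c v s) v := by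
  have hd : Continuous (deriv Φ) := hΦ.continuous_deriv le_rfl
  obtain ⟨C, hC⟩ := hc.deriv.exists_bound_of_continuous hd
  obtain ⟨A, hA⟩ := hc.deriv.isCompact.isBounded.subset_closedBall 0
  -- If `|w - v| < 1` and `|w + c u| ≤ A`, then `|c| u ≤ A + |v| + 1`.
  set B : ℝ := (A + |v| + 1) / |c| with hB
  have hmeas : ∀ (g : ℝ → ℂ), Continuous g → ∀ v, AEStronglyMeasurable
      (fun u : ℝ => (u : ℂ) ^ (s - 1) • g (v + c * u)) (volume.restrict (Ioi 0)) := by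
    intro g hg v
    simp only [smul_eq_mul]
    refine AEStronglyMeasurable.mul ?_
      (show Continuous fun u => g (v + c * u) by fun_prop).aestronglyMeasurable
    refine ContinuousOn.aestronglyMeasurable (fun t ht => ?_) measurableSet_Ioi
    exact (Complex.continuousAt_ofReal_cpow_const _ _ (Or.inr (ne_of_gt ht))).continuousWithinAt
  have hbd : Integrable ((Ioc 0 B).indicator fun u : ℝ => u ^ (s.re - 1) * C)
      (volume.restrict (Ioi 0)) := by
    refine Integrable.restrict ((integrable_indicator_iff measurableSet_Ioc).2 ?_)
    exact ((intervalIntegral.intervalIntegrable_rpow' (a := 0) (b := B)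
      (by linarith : -1 < s.re - 1)).1).mul_const C
  refine (hasDerivAt_integral_of_dominated_loc_of_deriv_le (𝕜 := ℝ) (s := Metric.ball v 1)
    (μ := volume.restrict (Ioi 0)) (F := fun (v u : ℝ) => (u : ℂ) ^ (s - 1) • Φ (v + c * u))
    (F' := fun (v u : ℝ) => (u : ℂ) ^ (s - 1) • deriv Φ (v + c * u))
    (Metric.ball_mem_nhds v one_pos) (Eventually.of_forall (hmeas Φ hΦ.continuous))
    (mellinConvergent_of_hasCompactSupport (by fun_prop)
      (hasCompactSupport_comp_affine hc0 hc v) hs)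
    (hmeas _ hd v) ?_ hbd ?_).2
  · refine (ae_restrict_iff' measurableSet_Ioi).2 (Eventually.of_forall fun u hu w hw => ?_)
    have hu : 0 < u := hu
    by_cases h : deriv Φ (w + c * u) = 0
    · rw [h, smul_zero, norm_zero]
      refine indicator_nonneg (fun x hx => ?_) _
      exact mul_nonneg (Real.rpow_nonneg hx.1.le _) ((norm_nonneg _).trans (hC 0))
    · have h1 := hA (subset_tsupport _ h)
      rw [mem_closedBall_zero_iff, Real.norm_eq_abs] at h1
      rw [Metric.mem_ball, Real.dist_eq] at hw
      have h2 : |c| * u ≤ A + |v| + 1 := by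
        have e : |c| * u = |(w + c * u) - (w - v) - v| := by
          rw [show (w + c * u) - (w - v) - v = c * u by ring, abs_mul, abs_of_pos hu]
        have := abs_sub ((w + c * u) - (w - v)) v
        have := abs_sub (w + c * u) (w - v)
        linarith
      have h3 : u ≤ B := by
        rw [hB, le_div_iff₀ (abs_pos.2 hc0), mul_comm]; exact h2
      rw [indicator_of_mem (show u ∈ Ioc 0 B from ⟨hu, h3⟩), norm_smul,
        Complex.norm_cpow_eq_rpow_re_of_pos hu, Complex.sub_re, Complex.one_re]
      exact mul_le_mul_of_nonneg_left (hC _) (Real.rpow_nonneg hu.le _)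
  · refine Eventually.of_forall fun u w _ => ?_
    have h : HasDerivAt (fun w => Φ (w + c * u)) (deriv Φ (w + c * u)) w :=
      ((hΦ.differentiable one_ne_zero (w + c * u)).hasDerivAt).comp_add_const w (c * u)
    exact h.const_mul _

/-- The analytic continuation of `a ↦ Γ(a)⁻¹ ∫₀^∞ Φ (v + c u) u^{a-1} du`, obtained by
integrating by parts `N` times. -/
noncomputable def rayRiesz (Φ : ℝ → ℂ) (c v : ℝ) (N : ℕ) (a : ℂ) : ℂ :=
  (-c : ℂ) ^ N * (Complex.Gamma (a + N))⁻¹ * rayMellin (iteratedDeriv N Φ) c v (a + N)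

lemma contDiff_iteratedDeriv (hΦ : ContDiff ℝ ∞ Φ) (N : ℕ) : ContDiff ℝ ∞ (iteratedDeriv N Φ) := by
  rw [iteratedDeriv_eq_iterate]; exact hΦ.iterate_deriv N

lemma hasCompactSupport_iteratedDeriv (hc : HasCompactSupport Φ) (N : ℕ) :
    HasCompactSupport (iteratedDeriv N Φ) := by
  induction N with
  | zero => simpa using hc
  | succ N ih => rw [iteratedDeriv_succ]; exact ih.deriv

/-- One more integration by parts produces the factor `a + N`, which the recursion of `1 / Γ`
absorbs. So the choice of `N` is immaterial. -/
lemma rayRiesz_succ (hΦ : ContDiff ℝ ∞ Φ) (hc : HasCompactSupport Φ) (hc0 : c ≠ 0) (v : ℝ) {N : ℕ}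
    {a : ℂ} (ha : 0 < a.re + N) : rayRiesz Φ c v (N + 1) a = rayRiesz Φ c v N a := by
  have h := rayMellin_deriv_add_one (s := a + N) ((contDiff_iteratedDeriv hΦ N).of_le (by simp))
    (hasCompactSupport_iteratedDeriv hc N) hc0 v (by simpa using ha)
  rw [rayRiesz, rayRiesz, Complex.one_div_Gamma_eq_self_mul_one_div_Gamma_add_one (a + N),
    iteratedDeriv_succ, Nat.cast_succ, ← add_assoc]
  linear_combination -(-c : ℂ) ^ N * (Complex.Gamma (a + N + 1))⁻¹ * h

lemma rayRiesz_eq_of_le (hΦ : ContDiff ℝ ∞ Φ) (hc : HasCompactSupport Φ) (hc0 : c ≠ 0) (v : ℝ)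
    {N M : ℕ} (hNM : N ≤ M) {a : ℂ} (ha : 0 < a.re + N) :
    rayRiesz Φ c v M a = rayRiesz Φ c v N a := by
  induction M, hNM using Nat.le_induction with
  | base => rfl
  | succ M hM ih =>
    have : (N : ℝ) ≤ M := by exact_mod_cast hM
    rw [rayRiesz_succ hΦ hc hc0 v (by linarith), ih]

/-- The Riemann-Liouville integral `Γ(a)⁻¹ ∫₀^∞ Φ (v + c u) u^{a-1} du` of a test function `Φ`,
continued analytically to all `a`. -/
noncomputable def riemannLiouville (Φ : ℝ → ℂ) (c v : ℝ) (a : ℂ) : ℂ :=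
  rayRiesz Φ c v (⌊|a.re|⌋₊ + 1) a

/-- The number of integrations by parts in `riemannLiouville` suffices to reach the half-plane of
convergence. -/
lemma re_add_floor_pos (a : ℂ) : 0 < a.re + ((⌊|a.re|⌋₊ + 1 : ℕ) : ℝ) := by
  have h1 := Nat.lt_floor_add_one |a.re|
  have h2 := neg_abs_le a.re
  push_cast
  linarith

lemma riemannLiouville_eq_rayRiesz (hΦ : ContDiff ℝ ∞ Φ) (hc : HasCompactSupport Φ) (hc0 : c ≠ 0)
    (v : ℝ) {N : ℕ} {a : ℂ} (ha : 0 < a.re + N) :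
    riemannLiouville Φ c v a = rayRiesz Φ c v N a := by
  rcases le_total N (⌊|a.re|⌋₊ + 1) with h | h
  · exact rayRiesz_eq_of_le hΦ hc hc0 v h ha
  · exact (rayRiesz_eq_of_le hΦ hc hc0 v h (re_add_floor_pos a)).symm

lemma riemannLiouville_of_re_pos (hΦ : ContDiff ℝ ∞ Φ) (hc : HasCompactSupport Φ) (hc0 : c ≠ 0)
    (v : ℝ) {a : ℂ} (ha : 0 < a.re) :
    riemannLiouville Φ c v a = (Complex.Gamma a)⁻¹ * rayMellin Φ c v a := by
  rw [riemannLiouville_eq_rayRiesz hΦ hc hc0 v (N := 0) (by simpa using ha)]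
  simp [rayRiesz]

lemma differentiable_riemannLiouville (hΦ : ContDiff ℝ ∞ Φ) (hc : HasCompactSupport Φ)
    (hc0 : c ≠ 0) (v : ℝ) : Differentiable ℂ (riemannLiouville Φ c v) := by
  intro a
  set N := ⌊|a.re|⌋₊ + 1
  have ha : 0 < a.re + N := re_add_floor_pos a
  -- The floor jumps with the argument, but the `N` belonging to `a` also serves at all nearby
  -- points.
  have hev : riemannLiouville Φ c v =ᶠ[𝓝 a] rayRiesz Φ c v N := by
    have : Continuous fun b : ℂ => b.re + N := by fun_prop
    filter_upwards [this.continuousAt.eventually (lt_mem_nhds ha)] with b hb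
    exact riemannLiouville_eq_rayRiesz hΦ hc hc0 v hb
  refine DifferentiableAt.congr_of_eventuallyEq ?_ hev
  have hadd : DifferentiableAt ℂ (fun b : ℂ => b + N) a := by fun_prop
  have hG := DifferentiableAt.comp a (Complex.differentiable_one_div_Gamma (a + N)) hadd
  have hM := DifferentiableAt.comp a (differentiableAt_rayMellin (s := a + N)
    (contDiff_iteratedDeriv hΦ N).continuous (hasCompactSupport_iteratedDeriv hc N) hc0 v
    (by simpa using ha)) hadd
  exact (hG.const_mul _).mul hM

/-- The number of integrations by parts depends on `a` alone, so it stays fixed while `v` varies,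
and the extra derivative commutes with the iterated one. -/
lemma hasDerivAt_riemannLiouville (hΦ : ContDiff ℝ ∞ Φ) (hc : HasCompactSupport Φ) (hc0 : c ≠ 0)
    (v : ℝ) (a : ℂ) :
    HasDerivAt (fun v => riemannLiouville Φ c v a) (riemannLiouville (deriv Φ) c v a) v := by
  have h := hasDerivAt_rayMellin (s := a + (⌊|a.re|⌋₊ + 1 : ℕ))
    ((contDiff_iteratedDeriv hΦ (⌊|a.re|⌋₊ + 1)).of_le (by simp))
    (hasCompactSupport_iteratedDeriv hc _) hc0 v (by simpa using re_add_floor_pos a)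
  rw [← iteratedDeriv_succ, iteratedDeriv_succ' (n := ⌊|a.re|⌋₊ + 1)] at h
  exact h.const_mul _

/-- With `N + 1` integrations by parts at `a - 1` and `N` at `a`, both sides contain the same Mellin
transform of the same derivative of `Φ`; only the power of `-c` differs. -/
lemma riemannLiouville_sub_one (hΦ : ContDiff ℝ ∞ Φ) (hc : HasCompactSupport Φ) (hc0 : c ≠ 0)
    (v : ℝ) (a : ℂ) :
    riemannLiouville Φ c v (a - 1) = -c * riemannLiouville (deriv Φ) c v a := by
  have ha := re_add_floor_pos a
  rw [riemannLiouville_eq_rayRiesz hΦ hc hc0 v (N := ⌊|a.re|⌋₊ + 1 + 1)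
    (by push_cast at ha ⊢; simp only [Complex.sub_re, Complex.one_re]; linarith),
    riemannLiouville, rayRiesz, rayRiesz, iteratedDeriv_succ',
    show a - 1 + ((⌊|a.re|⌋₊ + 1 + 1 : ℕ) : ℂ) = a + (⌊|a.re|⌋₊ + 1 : ℕ) by push_cast; ring,
    pow_succ]
  ring

end AffineComp

/-! ### Orbits of the isotropy group -/

section Orbit

variable {m : ℕ} {lam : Fin m → ℝ} {b₀ : ℝ}

lemma sinH_ne_zero (hlam : ∀ i, lam i ≠ 0) (hb₀ : Admissible lam b₀) (i : Fin m) :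
    sinH (lam i) b₀ ≠ 0 := by
  have hw : √|lam i| ≠ 0 := (Real.sqrt_pos.2 (abs_pos.2 (hlam i))).ne'
  have h0 : b₀ * √|lam i| ≠ 0 := mul_ne_zero hb₀.1 hw
  unfold sinH
  split_ifs with h
  · rw [Ne, Real.sin_eq_zero_iff]
    rintro ⟨k, hk⟩
    have hk0 : k ≠ 0 := by
      rintro rfl
      exact h0 (by rw [← hk, Int.cast_zero, zero_mul])
    exact hb₀.2 i h k hk0 (by rw [hk, abs_of_pos h])
  · rwa [Ne, Real.sinh_eq_zero]

/-- The point `g k . (b₀, 0, 0)` for `g` the lift of `(t, x, 0)` and `k ∈ K` with parameter `p`. -/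
noncomputable def orbitPoint (lam : Fin m → ℝ) (b₀ t : ℝ) (x p : Fin m → ℝ) : Space m :=
  act (lift lam (t, x, 0) * isoK lam p) (b₀, 0, 0)

/-- The coordinate `r` of the group is central, so the height of `y` and the height `s` merely add
up in `v`. -/
lemma act_lift_mul_isoK (p : Fin m → ℝ) (y : Space m) (s : ℝ) :
    act (lift lam y * isoK lam p) (b₀, 0, s) =
      orbitPoint lam b₀ y.1 y.2.1 p + (0, 0, y.2.2 + s) := by
  refine Prod.ext ?_ (Prod.ext ?_ ?_)
  · simp [orbitPoint, act, proj, lift, isoK]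
  · funext i
    simp [orbitPoint, act, proj, lift, isoK]
  · simp only [orbitPoint, act, proj, lift, isoK, mul_t, mul_p, mul_q, mul_r, Prod.snd_add]
    ring

/-- The slope in `p` does not depend on `t`, by `cosH_sq_add`; it is nonzero for admissible `b₀`,
which makes the orbit map proper. -/
lemma orbitPoint_snd_fst (t : ℝ) (x p : Fin m → ℝ) (i : Fin m) :
    (orbitPoint lam b₀ t x p).2.1 i =
      lam i / √|lam i| * sinH (lam i) b₀ * p i + (orbitPoint lam b₀ t x 0).2.1 i := by
  simp only [orbitPoint, act, proj, lift, isoK, mul_t, mul_p, mul_q, phiP, phiQ, Pi.zero_apply,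
    Pi.neg_apply, neg_zero, mul_zero, add_zero, cosH_add, sinH_add]
  linear_combination lam i / √|lam i| * sinH (lam i) b₀ * p i * cosH_sq_add (lam i) t

lemma continuous_orbitPoint (t : ℝ) (x : Fin m → ℝ) : Continuous (orbitPoint lam b₀ t x) := by
  unfold orbitPoint act proj lift isoK
  simp only [mul_t, mul_p, mul_q, mul_r, phiP, phiQ]
  fun_prop

lemma expMap_plusVector (hb₀ : b₀ ≠ 0) (r : ℝ) :
    expMap lam (plusVector m b₀ r) = (b₀, 0, r ^ 2 / (2 * b₀)) := by
  rw [expMap, if_neg (show (plusVector m b₀ r).1 ≠ 0 from hb₀)]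
  refine Prod.ext rfl (Prod.ext ?_ ?_) <;> simp only [plusVector]
  · funext i; simp
  · simp
    field_simp

/-- The parameters `p` of the orbit points lying over a compact set form a compact set. -/
lemma exists_isCompact_orbit (hlam : ∀ i, lam i ≠ 0) (hb₀ : Admissible lam b₀) (t : ℝ)
    (x : Fin m → ℝ) {S : Set (Space m)} (hS : IsCompact S) :
    ∃ P : Set (Fin m → ℝ), IsCompact P ∧
      ∀ p s, orbitPoint lam b₀ t x p + (0, 0, s) ∈ S → p ∈ P := by
  -- `Y` recovers `p` from the `x`-coordinates of the orbit point. It ignores `v`, so a single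
  -- compact set serves every shift `s`.
  let Y : Space m → Fin m → ℝ := fun z i =>
    (z.2.1 i - (orbitPoint lam b₀ t x 0).2.1 i) / (lam i / √|lam i| * sinH (lam i) b₀)
  have hY : Continuous Y := by fun_prop
  refine ⟨Y '' S, hS.image hY, fun p s h => ⟨_, h, funext fun i => ?_⟩⟩
  have hw : √|lam i| ≠ 0 := (Real.sqrt_pos.2 (abs_pos.2 (hlam i))).ne'
  have h0 : lam i / √|lam i| * sinH (lam i) b₀ ≠ 0 :=
    mul_ne_zero (div_ne_zero (hlam i) hw) (sinH_ne_zero hlam hb₀ i)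
  simp only [Y, Prod.snd_add, Prod.fst_add, Pi.add_apply, Pi.zero_apply, add_zero]
  rw [orbitPoint_snd_fst, add_sub_cancel_right, mul_div_cancel_left₀ _ h0]

/-- The orbital integral at `(t, x, v)` of `f` with `Exp₀ X = (b₀, 0, s)`, as a function of
`u = v + s`. -/
noncomputable def orbitMean (lam : Fin m → ℝ) (f : Space m → ℂ) (b₀ t : ℝ) (x : Fin m → ℝ)
    (u : ℝ) : ℂ :=
  ((∏ i, |lam i| : ℝ) : ℂ) * ∫ p, f (orbitPoint lam b₀ t x p + (0, 0, u))

lemma orbitalPlus_eq_orbitMean (f : Space m → ℂ) (hb₀ : b₀ ≠ 0) (r : ℝ) (y : Space m) :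
    orbitalPlus lam f b₀ r y =
      orbitMean lam f b₀ y.1 y.2.1 (y.2.2 + r ^ 2 / (2 * b₀)) := by
  simp only [orbitalPlus, orbitalIntegral, expMap_plusVector hb₀, act_lift_mul_isoK, orbitMean]

/-- In this form smoothness and compact support pass from `f` to its derivative in `v`. -/
lemma vDeriv_eq_fderiv {f : Space m → ℂ} (hf : Differentiable ℝ f) :
    vDeriv f = fun z => fderiv ℝ f z (0, 0, 1) := by
  funext z
  have h : HasDerivAt (fun v : ℝ => ((z.1, z.2.1, v) : Space m)) (0, 0, 1) z.2.2 :=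
    (hasDerivAt_const _ _).prodMk ((hasDerivAt_const _ _).prodMk (hasDerivAt_id _))
  exact ((hf z).hasFDerivAt.comp_hasDerivAt (z.2.2) h).deriv

lemma contDiff_vDeriv {f : Space m → ℂ} (hf : ContDiff ℝ ∞ f) : ContDiff ℝ ∞ (vDeriv f) := by
  rw [vDeriv_eq_fderiv (hf.differentiable (by simp))]
  exact (hf.fderiv_right (by simp)).clm_apply contDiff_const

lemma hasCompactSupport_vDeriv {f : Space m → ℂ} (hf : Differentiable ℝ f)
    (hfc : HasCompactSupport f) : HasCompactSupport (vDeriv f) := by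
  rw [vDeriv_eq_fderiv hf]
  exact hfc.fderiv_apply (𝕜 := ℝ) _

lemma hasDerivAt_vTranslate {f : Space m → ℂ} (hf : Differentiable ℝ f) (z : Space m) (u : ℝ) :
    HasDerivAt (fun u : ℝ => f (z + (0, 0, u))) (vDeriv f (z + (0, 0, u))) u := by
  rw [vDeriv_eq_fderiv hf]
  have h : HasDerivAt (fun u : ℝ => z + ((0, 0, u) : Space m)) (0, 0, 1) u :=
    ((hasDerivAt_const _ _).prodMk ((hasDerivAt_const _ _).prodMk (hasDerivAt_id _))).const_add z
  exact (hf _).hasFDerivAt.comp_hasDerivAt u h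

variable {f : Space m → ℂ}

lemma continuous_comp_orbitPoint (hf : Continuous f) (t : ℝ) (x : Fin m → ℝ) (u : ℝ) :
    Continuous fun p => f (orbitPoint lam b₀ t x p + (0, 0, u)) :=
  hf.comp ((continuous_orbitPoint t x).add continuous_const)

lemma integrable_comp_orbitPoint (hlam : ∀ i, lam i ≠ 0) (hb₀ : Admissible lam b₀)
    (hf : Continuous f) (hfc : HasCompactSupport f) (t : ℝ) (x : Fin m → ℝ) (u : ℝ) :
    Integrable fun p => f (orbitPoint lam b₀ t x p + (0, 0, u)) := by
  obtain ⟨P, hP, h⟩ := exists_isCompact_orbit hlam hb₀ t x hfc.isCompact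
  refine (continuous_comp_orbitPoint hf t x u).integrable_of_hasCompactSupport
    (HasCompactSupport.intro hP fun p hp => ?_)
  by_contra h0
  exact hp (h p u (subset_tsupport _ h0))

/-- The derivatives are dominated by a constant on a compact set of `p` independent of `u`, so the
integral may be differentiated under its sign. -/
lemma hasDerivAt_orbitMean (hlam : ∀ i, lam i ≠ 0) (hb₀ : Admissible lam b₀)
    (hf : ContDiff ℝ ∞ f) (hfc : HasCompactSupport f) (t : ℝ) (x : Fin m → ℝ) (u : ℝ) :
    HasDerivAt (orbitMean lam f b₀ t x) (orbitMean lam (vDeriv f) b₀ t x u) u := by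
  have hd : Differentiable ℝ f := hf.differentiable (by simp)
  have hv := (contDiff_vDeriv hf).continuous
  have hvc := hasCompactSupport_vDeriv hd hfc
  obtain ⟨C, hC⟩ := hvc.exists_bound_of_continuous hv
  obtain ⟨P, hP, h⟩ := exists_isCompact_orbit hlam hb₀ t x hvc.isCompact
  have hPint : Integrable (P.indicator fun _ : Fin m → ℝ => C) :=
    (integrable_indicator_iff hP.measurableSet).2 (integrableOn_const hP.measure_lt_top.ne)
  refine ((hasDerivAt_integral_of_dominated_loc_of_deriv_le (𝕜 := ℝ) (s := univ)
    (μ := volume) (F := fun u p => f (orbitPoint lam b₀ t x p + (0, 0, u)))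
    (F' := fun u p => vDeriv f (orbitPoint lam b₀ t x p + (0, 0, u)))
    univ_mem (Eventually.of_forall fun u =>
      (continuous_comp_orbitPoint hf.continuous t x u).aestronglyMeasurable)
    (integrable_comp_orbitPoint hlam hb₀ hf.continuous hfc t x u)
    (continuous_comp_orbitPoint hv t x u).aestronglyMeasurable
    (Eventually.of_forall fun p w _ => ?_) hPint
    (Eventually.of_forall fun p w _ => hasDerivAt_vTranslate hd _ w)).2).const_mul _
  by_cases hp : p ∈ P
  · rw [indicator_of_mem hp]; exact hC _
  · have : vDeriv f (orbitPoint lam b₀ t x p + (0, 0, w)) = 0 := by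
      by_contra h0
      exact hp (h p w (subset_tsupport _ h0))
    simp [this, hp]

lemma deriv_orbitMean (hlam : ∀ i, lam i ≠ 0) (hb₀ : Admissible lam b₀)
    (hf : ContDiff ℝ ∞ f) (hfc : HasCompactSupport f) (t : ℝ) (x : Fin m → ℝ) :
    deriv (orbitMean lam f b₀ t x) = orbitMean lam (vDeriv f) b₀ t x :=
  funext fun u => (hasDerivAt_orbitMean hlam hb₀ hf hfc t x u).deriv

/-- The derivative is again an orbital mean, of another test function; hence the induction with `f`
generalized. -/
lemma contDiff_orbitMean (hlam : ∀ i, lam i ≠ 0) (hb₀ : Admissible lam b₀)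
    (hf : ContDiff ℝ ∞ f) (hfc : HasCompactSupport f) (t : ℝ) (x : Fin m → ℝ) :
    ContDiff ℝ ∞ (orbitMean lam f b₀ t x) := by
  refine contDiff_infty.2 fun n => ?_
  induction n generalizing f with
  | zero =>
    exact contDiff_zero.2 (continuous_iff_continuousAt.2 fun u =>
      (hasDerivAt_orbitMean hlam hb₀ hf hfc t x u).continuousAt)
  | succ n ih =>
    rw [Nat.cast_succ, contDiff_succ_iff_deriv, deriv_orbitMean hlam hb₀ hf hfc]
    exact ⟨fun u => (hasDerivAt_orbitMean hlam hb₀ hf hfc t x u).differentiableAt, by simp,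
      ih (contDiff_vDeriv hf) (hasCompactSupport_vDeriv (hf.differentiable (by simp)) hfc)⟩

lemma hasCompactSupport_orbitMean (hlam : ∀ i, lam i ≠ 0) (hb₀ : Admissible lam b₀)
    (hfc : HasCompactSupport f) (t : ℝ) (x : Fin m → ℝ) :
    HasCompactSupport (orbitMean lam f b₀ t x) := by
  obtain ⟨P, hP, h⟩ := exists_isCompact_orbit hlam hb₀ t x hfc.isCompact
  -- A nonzero value forces `u` to be the `v`-coordinate of a point of the support minus that of an
  -- orbit point with parameter in `P`.
  have hQ : IsCompact ((fun w : Space m × (Fin m → ℝ) =>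
      w.1.2.2 - (orbitPoint lam b₀ t x w.2).2.2) '' (tsupport f ×ˢ P)) := by
    exact (hfc.isCompact.prod hP).image ((by fun_prop : Continuous fun w : Space m × (Fin m → ℝ) =>
      w.1.2.2).sub ((continuous_orbitPoint t x).comp continuous_snd).snd.snd)
  refine HasCompactSupport.intro hQ fun u hu => ?_
  have h0 : ∀ p, f (orbitPoint lam b₀ t x p + (0, 0, u)) = 0 := by
    intro p
    by_contra hne
    have hmem := subset_tsupport _ hne
    exact hu ⟨(_, p), ⟨hmem, h p u hmem⟩, by simp⟩
  simp [orbitMean, h0]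

end Orbit

/-! ### The generalized Riesz potentials -/

section Riesz

variable {m : ℕ} {lam : Fin m → ℝ} {b₀ : ℝ} {f : Space m → ℂ}

/-- The exponent `μ - n + 2 = μ - m` is written as `s - 1` with `s = μ - m + 1`, the form in which
the substitution `u = r²` applies to Mellin transforms. -/
lemma rieszIntegrand_eq (f : Space m → ℂ) (hb₀ : b₀ ≠ 0) (y : Space m) (μ : ℂ) (r : ℝ) :
    rieszIntegrand lam f b₀ y μ r = (r : ℂ) ^ ((μ - m + 1) - 1) •
      (fun u => orbitMean lam f b₀ y.1 y.2.1 (y.2.2 + (2 * b₀)⁻¹ * u)) (r ^ (2 : ℝ)) := by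
  rw [rieszIntegrand, orbitalPlus_eq_orbitMean f hb₀, smul_eq_mul, Real.rpow_two, mul_comm,
    div_eq_inv_mul]
  congr 2
  push_cast
  ring

lemma rieszConverges (hlam : ∀ i, lam i ≠ 0) (hb₀ : Admissible lam b₀) (hf : ContDiff ℝ ∞ f)
    (hfc : HasCompactSupport f) (y : Space m) : RieszConverges lam f b₀ y := by
  refine ⟨fun r _ => ?_, fun μ hμ => ?_⟩
  · simp only [expMap_plusVector hb₀.1, act_lift_mul_isoK]
    exact integrable_comp_orbitPoint hlam hb₀ hf.continuous hfc _ _ _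
  · rw [show rieszIntegrand lam f b₀ y μ = _ from funext (rieszIntegrand_eq f hb₀.1 y μ)]
    refine (MellinConvergent.comp_rpow two_ne_zero).2 (mellinConvergent_of_hasCompactSupport ?_
      (hasCompactSupport_comp_affine (inv_ne_zero (mul_ne_zero two_ne_zero hb₀.1))
        (hasCompactSupport_orbitMean hlam hb₀ hfc _ _) _) ?_)
    · exact (contDiff_orbitMean hlam hb₀ hf hfc _ _).continuous.comp (by fun_prop)
    · simp
      linarith

lemma rieszPotential_eq (f : Space m → ℂ) (hb₀ : b₀ ≠ 0) (y : Space m) (μ : ℂ) :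
    rieszPotential lam f b₀ y μ = 1 / rieszH (m + 1) μ * (1 / 2 *
      rayMellin (orbitMean lam f b₀ y.1 y.2.1) (2 * b₀)⁻¹ y.2.2 ((μ - m + 1) / 2)) := by
  rw [rieszPotential, funext fun r => rieszIntegrand_eq f hb₀ y μ r]
  have h := mellin_comp_rpow (fun u => orbitMean lam f b₀ y.1 y.2.1 (y.2.2 + (2 * b₀)⁻¹ * u))
    (μ - m + 1) 2
  rw [mellin] at h
  rw [h, rayMellin, Complex.real_smul]
  norm_num

/-- The analytic continuation in `μ` of the generalized Riesz potential. -/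
noncomputable def rieszContinuation (lam : Fin m → ℝ) (f : Space m → ℂ) (b₀ : ℝ) (y : Space m)
    (μ : ℂ) : ℂ :=
  (2 * (Real.pi : ℂ) ^ (((m : ℂ) - 1) / 2))⁻¹ * (2 : ℂ) ^ (1 - μ) * (Complex.Gamma (μ / 2))⁻¹ *
    riemannLiouville (orbitMean lam f b₀ y.1 y.2.1) (2 * b₀)⁻¹ y.2.2 ((μ - m + 1) / 2)

lemma differentiable_rieszContinuation (hlam : ∀ i, lam i ≠ 0) (hb₀ : Admissible lam b₀)
    (hf : ContDiff ℝ ∞ f) (hfc : HasCompactSupport f) (y : Space m) :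
    Differentiable ℂ (rieszContinuation lam f b₀ y) := by
  have hR := differentiable_riemannLiouville (contDiff_orbitMean hlam hb₀ hf hfc y.1 y.2.1)
    (hasCompactSupport_orbitMean hlam hb₀ hfc y.1 y.2.1)
    (inv_ne_zero (mul_ne_zero two_ne_zero hb₀.1)) y.2.2
  have h1 : Differentiable ℂ fun μ : ℂ => (Complex.Gamma (μ / 2))⁻¹ :=
    Complex.differentiable_one_div_Gamma.comp (differentiable_id.div_const 2)
  have h2 := hR.comp (by fun_prop : Differentiable ℂ fun μ : ℂ => (μ - m + 1) / 2)
  have h3 : Differentiable ℂ fun μ : ℂ => (2 : ℂ) ^ (1 - μ) := fun μ =>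
    ((differentiableAt_const _).sub differentiableAt_id).const_cpow (Or.inl two_ne_zero)
  exact ((h3.const_mul _).mul h1).mul h2

/-- For `Re μ > m + 1` the argument `(μ - m + 1) / 2` has positive real part, so no continuation is
needed and its Gamma factor is the second one of `rieszH`. -/
lemma isEntireExtension_rieszContinuation (hlam : ∀ i, lam i ≠ 0) (hb₀ : Admissible lam b₀)
    (hf : ContDiff ℝ ∞ f) (hfc : HasCompactSupport f) (y : Space m) :
    IsEntireExtension lam f b₀ y (rieszContinuation lam f b₀ y) := by
  refine ⟨differentiable_rieszContinuation hlam hb₀ hf hfc y, fun μ hμ => ?_⟩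
  have hre : 0 < ((μ - m + 1) / 2).re := by simp; linarith
  rw [rieszPotential_eq f hb₀.1, rieszContinuation, riemannLiouville_of_re_pos
    (contDiff_orbitMean hlam hb₀ hf hfc y.1 y.2.1)
    (hasCompactSupport_orbitMean hlam hb₀ hfc y.1 y.2.1)
    (inv_ne_zero (mul_ne_zero two_ne_zero hb₀.1)) _ hre, rieszH,
    show ((m + 1 : ℕ) : ℂ) - 2 = m - 1 by push_cast; ring,
    show μ + 2 - ((m + 1 : ℕ) : ℂ) = μ - m + 1 by push_cast; ring,
    show (1 : ℂ) - μ = -(μ - 1) by ring, Complex.cpow_neg]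
  simp only [one_div, mul_inv]
  ring

/-- The factor `1 / Γ(μ/2)` vanishes at `μ = 0`; the conventions `Γ(0) = 0` and `0⁻¹ = 0` agree with
this value of the entire function `1 / Γ`. -/
lemma rieszContinuation_zero (f : Space m → ℂ) (y : Space m) :
    rieszContinuation lam f b₀ y 0 = 0 := by
  simp [rieszContinuation]

/-- The height `v` enters only as the base point of the ray; the other factors depend on `μ` and `m`
alone. -/
lemma hasDerivAt_rieszContinuation (hlam : ∀ i, lam i ≠ 0) (hb₀ : Admissible lam b₀)
    (hf : ContDiff ℝ ∞ f) (hfc : HasCompactSupport f) (t : ℝ) (x : Fin m → ℝ) (v : ℝ) (μ : ℂ) :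
    HasDerivAt (fun v' : ℝ => rieszContinuation lam f b₀ (t, x, v') μ)
      (rieszContinuation lam (vDeriv f) b₀ (t, x, v) μ) v := by
  have h := hasDerivAt_riemannLiouville (contDiff_orbitMean hlam hb₀ hf hfc t x)
    (hasCompactSupport_orbitMean hlam hb₀ hfc t x)
    (inv_ne_zero (mul_ne_zero two_ne_zero hb₀.1)) v ((μ - m + 1) / 2)
  rw [deriv_orbitMean hlam hb₀ hf hfc] at h
  exact h.const_mul _

/-- Passing from `μ` to `μ - 2` costs `4` from the power of `2`, `(μ - 2) / 2` from `1 / Γ(μ/2)` and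
`-(2 b₀)⁻¹` from the Riemann-Liouville integral; together these give `-(μ - 2) / b₀`. -/
lemma rieszContinuation_vDeriv (hlam : ∀ i, lam i ≠ 0) (hb₀ : Admissible lam b₀)
    (hf : ContDiff ℝ ∞ f) (hfc : HasCompactSupport f) (y : Space m) {μ : ℂ} (hμ : μ ≠ 2) :
    rieszContinuation lam (vDeriv f) b₀ y μ =
      -((b₀ : ℂ) / (μ - 2)) * rieszContinuation lam f b₀ y (μ - 2) := by
  have hR := riemannLiouville_sub_one (contDiff_orbitMean hlam hb₀ hf hfc y.1 y.2.1)
    (hasCompactSupport_orbitMean hlam hb₀ hfc y.1 y.2.1)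
    (inv_ne_zero (mul_ne_zero two_ne_zero hb₀.1)) y.2.2 ((μ - m + 1) / 2)
  rw [deriv_orbitMean hlam hb₀ hf hfc,
    show (μ - m + 1) / 2 - 1 = (μ - 2 - m + 1) / 2 by ring] at hR
  have hG := Complex.one_div_Gamma_eq_self_mul_one_div_Gamma_add_one ((μ - 2) / 2)
  rw [show (μ - 2) / 2 + 1 = μ / 2 by ring] at hG
  have h2 : (2 : ℂ) ^ (1 - (μ - 2)) = 4 * 2 ^ (1 - μ) := by
    rw [show 1 - (μ - 2) = 2 + (1 - μ) by ring, Complex.cpow_add _ _ two_ne_zero]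
    norm_num
  have hb : (b₀ : ℂ) ≠ 0 := Complex.ofReal_ne_zero.2 hb₀.1
  have hμ' : μ - 2 ≠ 0 := sub_ne_zero.2 hμ
  rw [rieszContinuation, rieszContinuation, hR, hG, h2]
  push_cast
  field_simp
  ring

end Riesz

end CahenWallach

/-! ### The main theorem -/

theorem mainTheorem6 (m : ℕ) (lam : Fin m → ℝ) (hlam : ∀ i, lam i ≠ 0)
    (f : CahenWallach.Space m → ℂ) (hf : ContDiff ℝ ∞ f) (hfc : HasCompactSupport f)
    (b₀ : ℝ) (hb₀ : CahenWallach.Admissible lam b₀) :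
    ∃ J Jv : CahenWallach.Space m → ℂ → ℂ,
      (∀ y, CahenWallach.RieszConverges lam f b₀ y ∧
        CahenWallach.IsEntireExtension lam f b₀ y (J y)) ∧
      (∀ y, CahenWallach.RieszConverges lam (CahenWallach.vDeriv f) b₀ y ∧
        CahenWallach.IsEntireExtension lam (CahenWallach.vDeriv f) b₀ y (Jv y)) ∧
      (∀ y, Filter.Tendsto (J y) (𝓝 0) (𝓝 0)) ∧
      (∀ (t : ℝ) (x : Fin m → ℝ) (v : ℝ) (μ : ℂ),
        HasDerivAt (fun v' : ℝ => J (t, x, v') μ) (Jv (t, x, v) μ) v) ∧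
      (∀ (y : CahenWallach.Space m) (μ : ℂ), μ ≠ 2 →
        Jv y μ = -((b₀ : ℂ) / (μ - 2)) * J y (μ - 2)) ∧
      (∀ y : CahenWallach.Space m,
        Filter.Tendsto (fun μ : ℂ => -((b₀ : ℂ) / (μ - 2)) * J y (μ - 2)) (𝓝[≠] 2)
          (𝓝 (Jv y 2))) := by
  open CahenWallach in
  have hf' : ContDiff ℝ ∞ (vDeriv f) := contDiff_vDeriv hf
  have hfc' : HasCompactSupport (vDeriv f) :=
    hasCompactSupport_vDeriv (hf.differentiable (by simp)) hfc
  refine ⟨rieszContinuation lam f b₀, rieszContinuation lam (vDeriv f) b₀,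
    fun y => ⟨rieszConverges hlam hb₀ hf hfc y,
      isEntireExtension_rieszContinuation hlam hb₀ hf hfc y⟩,
    fun y => ⟨rieszConverges hlam hb₀ hf' hfc' y,
      isEntireExtension_rieszContinuation hlam hb₀ hf' hfc' y⟩,
    fun y => ?_, hasDerivAt_rieszContinuation hlam hb₀ hf hfc,
    fun y μ hμ => rieszContinuation_vDeriv hlam hb₀ hf hfc y hμ, fun y => ?_⟩
  · have h := (differentiable_rieszContinuation hlam hb₀ hf hfc y).continuous.tendsto 0
    rwa [rieszContinuation_zero] at h
  -- The limit at `μ = 2` follows from continuity of the potential of `∂f/∂v`, which equals the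
  -- quotient away from `2`.
  · have h := (differentiable_rieszContinuation hlam hb₀ hf' hfc' y).continuous.tendsto 2
    refine (h.mono_left nhdsWithin_le_nhds).congr' ?_
    filter_upwards [self_mem_nhdsWithin] with μ hμ
    exact rieszContinuation_vDeriv hlam hb₀ hf hfc y hμ
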